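/- Let $n,p\in\mathbb{N}$, $X\in\mathbb{R}^{n\times p}$, and let $w\in\mathbb{R}^p$ satisfy $w_1>\dots>w_p>0$. For $b\in\mathbb{R}^p$ let $\|b\|_w=\sum_{j=1}^p w_j|b|_{(j)}$ be the SLOPE norm, where $|b|_{(1)}\ge\dots\ge|b|_{(p)}$ are the absolute values of the components of $b$ in non-increasing order, and for $y\in\mathbb{R}^n$ let $$S_{X,\|\cdot\|_w}(y)=\operatorname*{arg\,min}_{b\in\mathbb{R}^p}\ \tfrac12\|y-Xb\|_2^2+\|b\|_w .$$ Let $P_w^\pm=\mathrm{conv}\{(\sigma_1w_{\pi(1)},\dots,\sigma_pw_{\pi(p)})' : \sigma_1,\dots,\sigma_p\in\{-1,1\},\ \pi\in\mathcal{S}_p\}$ be the sign permutahedron. A face of $P_w^\pm$ is a set $F=\{x\in P_w^\pm : a'x=b_0\}$ with $a\in\mathbb{R}^p$, $b_0\in\mathbb{R}$ such that $a'x\le b_0$ for all $x\in P_w^\pm$; the codimension of a nonempty face $F$ is $p$ minus the dimension of its affine hull. Let $\mathrm{row}(X)\subseteq\mathbb{R}^p$ be the row space of $X$ and $\mathrm{rk}(X)$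 its rank. A vector $m\in\mathbb{Z}^p$ is a SLOPE model if $m=0$ or if for every integer $1\le l\le\|m\|_\infty$ there is $j$ with $|m_j|=l$. For $x\in\mathbb{R}^p$, $\mathrm{mdl}(x)$ is the unique SLOPE model such that $\mathrm{sign}(\mathrm{mdl}(x)_i)=\mathrm{sign}(x_i)$ for all $i$, $|x_i|=|x_j|$ implies $|\mathrm{mdl}(x)_i|=|\mathrm{mdl}(x)_j|$, and $|x_i|>|x_j|$ implies $|\mathrm{mdl}(x)_i|>|\mathrm{mdl}(x)_j|$. The non-null clusters of $x$ are the nonempty sets of the form $\{i : |x_i|=c\}$ with $c>0$. Suppose that $\mathrm{row}(X)$ does not intersect any face of $P_w^\pm$ whose codimension is larger than $\mathrm{rk}(X)$. Then for every $y\in\mathbb{R}^n$ the set $S_{X,\|\cdot\|_w}(y)$ consists of exactly one element $\hat\beta_w(y)$; the number of non-null clusters of $\hat\beta_w(y)$ equals $\|\mathrm{mdl}(\hat\beta_w(y))\|_\infty$, and $$\|\mathrm{mdl}(\hat\beta_w(y))\|_\infty\le\mathrm{rk}(X).$$ -/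

import Mathlib

namespace SLOPE

open Matrix

/-- The absolute values of the components of `b`, in non-increasing order:
`absSort b j` is the order statistic `|b|_(j)` (with indices starting at `0`). -/
noncomputable def absSort {p : ℕ} (b : Fin p → ℝ) : Fin p → ℝ :=
  fun j => |b (Tuple.sort (fun i => -|b i|) j)|

theorem absSort_antitone {p : ℕ} (b : Fin p → ℝ) : Antitone (absSort b) := by
  intro i j hij
  have h := Tuple.monotone_sort (fun i => -|b i|) hij
  simp only [Function.comp_apply] at h
  unfold absSort
  linarith

/-- The SLOPE norm `‖b‖_w = ∑ j, w_j |b|_(j)`. -/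
noncomputable def slopeNorm {p : ℕ} (w b : Fin p → ℝ) : ℝ :=
  ∑ j, w j * absSort b j

/-- The SLOPE objective `(1/2) ‖y - X b‖₂² + ‖b‖_w`. -/
noncomputable def objective {n p : ℕ} (X : Matrix (Fin n) (Fin p) ℝ) (w : Fin p → ℝ)
    (y : Fin n → ℝ) (b : Fin p → ℝ) : ℝ :=
  (1 / 2) * ‖WithLp.toLp 2 (y - X *ᵥ b)‖ ^ 2 + slopeNorm w b

/-- The set of SLOPE minimizers `S_{X,‖·‖_w}(y)`. -/
def minimizers {n p : ℕ} (X : Matrix (Fin n) (Fin p) ℝ) (w : Fin p → ℝ)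
    (y : Fin n → ℝ) : Set (Fin p → ℝ) :=
  {b | ∀ b' : Fin p → ℝ, objective X w y b ≤ objective X w y b'}

/-- The sign permutahedron `P_w^±`. -/
def signPermutahedron {p : ℕ} (w : Fin p → ℝ) : Set (Fin p → ℝ) :=
  convexHull ℝ {v | ∃ (σ : Fin p → ℝ) (π : Equiv.Perm (Fin p)),
    (∀ i, σ i = 1 ∨ σ i = -1) ∧ v = fun i => σ i * w (π i)}

/-- `F` is a face of `P`: it is cut out of `P` by equality in a valid inequality
`a'x ≤ b₀` of `P`. -/
def IsFace {p : ℕ} (P F : Set (Fin p → ℝ)) : Prop :=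
  ∃ (a : Fin p → ℝ) (b₀ : ℝ), (∀ x ∈ P, a ⬝ᵥ x ≤ b₀) ∧ F = {x ∈ P | a ⬝ᵥ x = b₀}

/-- The codimension `p - dim (aff F)` of a nonempty subset `F` of `ℝ^p`. The subtraction
never truncates, because `vectorSpan ℝ F` is a subspace of `ℝ^p`. -/
noncomputable def codim {p : ℕ} (F : Set (Fin p → ℝ)) : ℕ :=
  p - Module.finrank ℝ (vectorSpan ℝ F)

/-- The row space of `X`. -/
def rowSpace {n p : ℕ} (X : Matrix (Fin n) (Fin p) ℝ) : Submodule ℝ (Fin p → ℝ) :=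
  Submodule.span ℝ (Set.range X.row)

/-- SLOPE models: either `m = 0`, or every `l ∈ {1, …, ‖m‖_∞}` is the absolute value of
some component of `m`. The norm is the sup norm on `ℤ^p`. -/
def IsModel {p : ℕ} (m : Fin p → ℤ) : Prop :=
  m = 0 ∨ ∀ l : ℕ, 1 ≤ l → (l : ℝ) ≤ ‖m‖ → ∃ j, |m j| = (l : ℤ)

/-- `m` is a SLOPE model with the signs of `x` and with the same ordering of the
absolute values of its components as `x`. -/
structure IsModelOf {p : ℕ} (x : Fin p → ℝ) (m : Fin p → ℤ) : Prop where
  isModel : IsModel m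
  sign_eq : ∀ i, SignType.sign (m i) = SignType.sign (x i)
  abs_eq : ∀ i j, |x i| = |x j| → |m i| = |m j|
  abs_lt : ∀ i j, |x j| < |x i| → |m j| < |m i|

/-- The distinct nonzero absolute values of components of `x` that are at most `t`. -/
noncomputable def levels {p : ℕ} (x : Fin p → ℝ) (t : ℝ) : Finset ℝ :=
  (Finset.univ.image fun j => |x j|).filter fun c => 0 < c ∧ c ≤ t

/-- The model `mdl(x)` of `x`: the component `i` has the sign of `x_i`, and its absolute
value is the rank of `|x_i|` among the distinct nonzero absolute values of the components
of `x`. By `mdl_isModelOf` and `IsModelOf.eq_mdl` it is the only SLOPE model that is a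
model of `x`. -/
noncomputable def mdl {p : ℕ} (x : Fin p → ℝ) : Fin p → ℤ :=
  fun i => (SignType.sign (x i) : ℤ) * ((levels x |x i|).card : ℤ)

/-- The non-null clusters of `x`: the nonempty sets of all indices `i` whose `|x_i|` has
a given positive value. -/
def nonNullClusters {p : ℕ} (x : Fin p → ℝ) : Set (Set (Fin p)) :=
  {C | C.Nonempty ∧ ∃ c : ℝ, 0 < c ∧ C = {i | |x i| = c}}

theorem abs_mdl {p : ℕ} (x : Fin p → ℝ) (i : Fin p) :
    |mdl x i| = ((levels x |x i|).card : ℤ) := by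
  rcases lt_trichotomy (x i) 0 with h | h | h
  · simp [mdl, sign_neg h]
  · have : levels x 0 = ∅ := by
      ext c; simp [levels]
    simp [mdl, h, this]
  · simp [mdl, sign_pos h]

theorem levels_card_lt {p : ℕ} (x : Fin p → ℝ) (i : Fin p) {t : ℝ} (h0 : x i ≠ 0)
    (h : t < |x i|) : (levels x t).card < (levels x |x i|).card := by
  apply Finset.card_lt_card
  refine (Finset.ssubset_iff_of_subset ?_).2 ⟨|x i|, ?_, ?_⟩
  · intro c hc
    simp only [levels, Finset.mem_filter] at hc ⊢
    exact ⟨hc.1, hc.2.1, hc.2.2.trans h.le⟩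
  · simp [levels, h0]
  · simp [levels, h]

theorem exists_levels_card {p : ℕ} (x : Fin p → ℝ) (k : ℕ) :
    ∀ t : ℝ, (levels x t).card = k → ∀ l, 1 ≤ l → l ≤ k →
      ∃ j, x j ≠ 0 ∧ (levels x |x j|).card = l := by
  induction k with
  | zero => intro t _ l h1 h2; omega
  | succ k ih =>
    intro t ht l h1 h2
    have hne : (levels x t).Nonempty := by
      rw [← Finset.card_pos]; omega
    obtain ⟨hm, hmax⟩ := Finset.isGreatest_max' _ hne
    set c := (levels x t).max' hne
    obtain ⟨hc, hc0, hct⟩ : (∃ j, |x j| = c) ∧ 0 < c ∧ c ≤ t := by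
      simpa [levels] using hm
    obtain ⟨j, hj⟩ := hc
    have hjc : levels x c = levels x t := by
      ext d
      constructor
      · intro hd
        simp only [levels, Finset.mem_filter] at hd ⊢
        exact ⟨hd.1, hd.2.1, hd.2.2.trans hct⟩
      · intro hd
        have := hmax hd
        simp only [levels, Finset.mem_filter] at hd ⊢
        exact ⟨hd.1, hd.2.1, this⟩
    rcases Nat.lt_or_ge l (k + 1) with hl | hl
    · -- remove the largest level
      by_cases hs : ((levels x t).erase c).Nonempty
      · obtain ⟨hm', hmax'⟩ := Finset.isGreatest_max' _ hs
        set d := ((levels x t).erase c).max' hs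
        have hd : levels x d = (levels x t).erase c := by
          ext e
          constructor
          · intro he
            have hdc : d < c := lt_of_le_of_ne (hmax (Finset.mem_of_mem_erase hm'))
              (Finset.ne_of_mem_erase hm')
            simp only [levels, Finset.mem_filter, Finset.mem_erase] at he ⊢
            exact ⟨(he.2.2.trans_lt hdc).ne, he.1, he.2.1, he.2.2.trans (hdc.le.trans hct)⟩
          · intro he
            have := hmax' he
            simp only [levels, Finset.mem_filter, Finset.mem_erase] at he ⊢
            exact ⟨he.2.1, he.2.2.1, this⟩
        refine ih d ?_ l h1 (by omega)
        rw [hd, Finset.card_erase_of_mem hm, ht]; rfl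
      · have : ((levels x t).erase c).card = 0 := by
          rw [Finset.not_nonempty_iff_eq_empty] at hs
          simp [hs]
        rw [Finset.card_erase_of_mem hm] at this
        omega
    · refine ⟨j, ?_, ?_⟩
      · intro h; rw [h, abs_zero] at hj; linarith
      · rw [hj, hjc]; omega

theorem mdl_isModelOf {p : ℕ} (x : Fin p → ℝ) : IsModelOf x (mdl x) := by
  refine ⟨?_, ?_, ?_, ?_⟩
  · right
    intro l h1 hl
    have hex : ∃ i, (l : ℤ) ≤ |mdl x i| := by
      by_contra! hcon
      have : ‖mdl x‖ < (l : ℝ) := by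
        rw [pi_norm_lt_iff (by exact_mod_cast h1)]
        intro i
        rw [Int.norm_eq_abs]
        exact_mod_cast hcon i
      linarith
    obtain ⟨i, hi⟩ := hex
    rw [abs_mdl] at hi
    obtain ⟨j, _, hj⟩ := exists_levels_card x _ |x i| rfl l h1 (by exact_mod_cast hi)
    exact ⟨j, by rw [abs_mdl, hj]⟩
  · intro i
    rcases lt_trichotomy (x i) 0 with h | h | h
    · have := levels_card_lt x i (t := 0) h.ne (abs_pos.2 h.ne)
      have h' : mdl x i < 0 := by simp only [mdl, sign_neg h, SignType.coe_neg_one]; omega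
      rw [sign_neg h, sign_neg h']
    · simp [mdl, h]
    · have := levels_card_lt x i (t := 0) h.ne' (abs_pos.2 h.ne')
      have h' : 0 < mdl x i := by simp only [mdl, sign_pos h, SignType.coe_one]; omega
      rw [sign_pos h, sign_pos h']
  · intro i j h
    rw [abs_mdl, abs_mdl, h]
  · intro i j h
    rw [abs_mdl, abs_mdl]
    have h0 : x i ≠ 0 := abs_pos.1 ((abs_nonneg _).trans_lt h)
    exact_mod_cast levels_card_lt x i h0 h

theorem IsModelOf.eq_mdl {p : ℕ} {x : Fin p → ℝ} {m : Fin p → ℤ} (h : IsModelOf x m) :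
    m = mdl x := by
  have hz : ∀ i, m i = 0 ↔ x i = 0 := fun i => by
    rw [← sign_eq_zero_iff, h.sign_eq, sign_eq_zero_iff]
  have hlt : ∀ i j, |m j| < |m i| ↔ |x j| < |x i| := fun i j => by
    refine ⟨fun hm => ?_, h.abs_lt i j⟩
    by_contra! hx
    rcases hx.lt_or_eq with hx | hx
    · exact absurd (h.abs_lt j i hx) (by omega)
    · exact absurd (h.abs_eq i j hx) (by omega)
  have heq : ∀ i j, |m j| = |m i| ↔ |x j| = |x i| := fun i j => by
    refine ⟨fun hm => ?_, h.abs_eq j i⟩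
    rcases lt_trichotomy |x j| |x i| with hx | hx | hx
    · exact absurd (h.abs_lt i j hx) (by omega)
    · exact hx
    · exact absurd (h.abs_lt j i hx) (by omega)
  have key : ∀ i, |m i| = |mdl x i| := fun i => by
    rw [abs_mdl]
    have hcard : (levels x |x i|).card = (Finset.Icc 1 |m i|).card := by
      have himg : Finset.Icc 1 |m i| =
          (Finset.univ.filter fun j => x j ≠ 0 ∧ |x j| ≤ |x i|).image fun j => |m j| := by
        ext l
        simp only [Finset.mem_Icc, Finset.mem_image, Finset.mem_filter, Finset.mem_univ,
          true_and]
        constructor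
        · rintro ⟨h1, h2⟩
          rcases h.isModel with h0 | hM
          · rw [h0] at h2; simp at h2; omega
          · obtain ⟨j, hj⟩ := hM l.toNat (by omega) (by
              refine le_trans ?_ (norm_le_pi_norm m i)
              rw [Int.norm_eq_abs]
              have : ((l.toNat : ℤ)) ≤ |m i| := by omega
              exact_mod_cast this)
            refine ⟨j, ⟨?_, ?_⟩, by omega⟩
            · rw [Ne, ← hz]; intro h0; rw [h0, abs_zero] at hj; omega
            · by_contra! hx
              have := h.abs_lt j i hx
              omega
        · rintro ⟨j, ⟨hj0, hj⟩, rfl⟩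
          refine ⟨?_, ?_⟩
          · rw [Ne, ← hz] at hj0
            exact Int.one_le_abs hj0
          · by_contra! hm
            exact absurd ((hlt j i).1 hm) (by linarith)
      have himg' : levels x |x i| =
          (Finset.univ.filter fun j => x j ≠ 0 ∧ |x j| ≤ |x i|).image fun j => |x j| := by
        ext c
        simp only [levels, Finset.mem_image, Finset.mem_filter, Finset.mem_univ, true_and]
        constructor
        · rintro ⟨⟨j, rfl⟩, h1, h2⟩
          exact ⟨j, ⟨abs_pos.1 h1, h2⟩, rfl⟩
        · rintro ⟨j, ⟨h1, h2⟩, rfl⟩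
          exact ⟨⟨j, rfl⟩, abs_pos.2 h1, h2⟩
      rw [himg, himg']
      set s := Finset.univ.filter fun j => x j ≠ 0 ∧ |x j| ≤ |x i|
      refine Finset.card_bij' (s := s.image fun j => |x j|) (t := s.image fun j => |m j|)
        (fun c hc => |m (Finset.mem_image.1 hc).choose|)
        (fun l hl => |x (Finset.mem_image.1 hl).choose|) ?_ ?_ ?_ ?_
      · intro c hc
        exact Finset.mem_image_of_mem _ (Finset.mem_image.1 hc).choose_spec.1
      · intro l hl
        exact Finset.mem_image_of_mem _ (Finset.mem_image.1 hl).choose_spec.1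
      · intro c hc
        generalize_proofs _ h2
        rw [(heq _ _).1 h2.choose_spec.2]
        exact (Finset.mem_image.1 hc).choose_spec.2
      · intro l hl
        generalize_proofs _ h2
        rw [(heq _ _).2 h2.choose_spec.2]
        exact (Finset.mem_image.1 hl).choose_spec.2
    rw [hcard, Int.card_Icc]
    have := abs_nonneg (m i)
    omega
  funext i
  have hs := (h.sign_eq i).trans ((mdl_isModelOf x).sign_eq i).symm
  have e1 := sign_mul_abs (m i)
  have e2 := sign_mul_abs (mdl x i)
  rw [← e1, ← e2, hs, key i]

end SLOPE

/-! The SLOPE norm is the support function of `P_w^±`. For a minimizer `β`, optimality says that `s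
= Xᵀ(y - Xβ)`, which lies in `row(X)`, belongs to `P_w^±` and satisfies `s·β = ‖β‖_w`. So `row(X)`
meets the face `maxFace w β` on which `β` is maximal, and by hypothesis its codimension is at most
`rk(X)`.

Cluster bound: the signed indicator of each non-null cluster of `β` is constant on `maxFace w β`
(`clusterVec_dotProduct_eq`). These vectors are linearly independent and orthogonal to the
directions of the face, so there are at most as many as its codimension (`card_posLevels_le_codim`).

Uniqueness (`exists_maxFace_codim_gt`): two minimizers `β ≠ γ` have the same fit, hence the same
`s`, and `β - γ` is orthogonal to `row(X)`. Take an extreme point `z` of the part of `row(X)` in the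
face maximizing `β + γ`, and let `W` be spanned by `β`, `γ` and the sign vectors that `z` maximizes.
Extremality leaves no nonzero direction of `row(X)` orthogonal to `W`, while `β - γ ∈ W` is
orthogonal to `row(X)`, so `dim W > rk(X)`. Since `W` is constant on a face containing `z`, that
face has codimension larger than `rk(X)`, a contradiction. -/

namespace SLOPE

open Matrix

/-! ### The SLOPE norm as a maximum over the sign permutahedron -/

section Norm

variable {p : ℕ} {w : Fin p → ℝ}

/-- A permutation putting the absolute values of `b` in non-increasing order computes
`absSort b`. -/
theorem absSort_eq_of_antitone (b : Fin p → ℝ) (π : Equiv.Perm (Fin p))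
    (h : Antitone fun j => |b (π j)|) (j : Fin p) : absSort b j = |b (π j)| := by
  have hm : Monotone ((fun i => -|b i|) ∘ π) := fun i j hij => neg_le_neg (h hij)
  have := congrFun (Tuple.comp_sort_eq_comp_iff_monotone.2 hm) j
  simp only [Function.comp_apply, neg_inj] at this
  rw [this, absSort]

/-- There is a vertex of the sign permutahedron at which the norm of every vector with the
signs and the order of absolute values of `b` (in the weak sense) is attained. -/
theorem exists_common_maximizer (w b : Fin p → ℝ) :
    ∃ v ∈ signPermutahedron w, ∀ b' : Fin p → ℝ,
      (∀ i, 0 ≤ (if 0 ≤ b i then 1 else -1) * b' i) →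
      (∀ i j, |b j| ≤ |b i| → |b' j| ≤ |b' i|) → v ⬝ᵥ b' = slopeNorm w b' := by
  set π := Tuple.sort fun i => -|b i|
  -- Zero entries of `b` get the sign `+1`, so `b'` has to be nonnegative there.
  set ε : Fin p → ℝ := fun i => if 0 ≤ b i then 1 else -1
  have hε : ∀ i, ε i = 1 ∨ ε i = -1 := fun i => by
    simp only [ε]; split_ifs <;> simp
  refine ⟨fun i => ε i * w (π.symm i), subset_convexHull ℝ _ ⟨ε, π.symm, hε, rfl⟩, ?_⟩
  intro b' hsign hord
  have hanti : Antitone fun j => |b' (π j)| := fun i j hij =>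
    hord _ _ (absSort_antitone b hij)
  have habs : ∀ i, ε i * b' i = |b' i| := fun i => by
    rw [← abs_of_nonneg (hsign i), abs_mul]
    rcases hε i with h | h <;> simp only [ε] at h <;> rw [h] <;> simp
  simp only [slopeNorm, dotProduct, absSort_eq_of_antitone b' π hanti]
  rw [← Equiv.sum_comp π]
  refine Finset.sum_congr rfl fun j _ => ?_
  rw [Equiv.symm_apply_apply, mul_right_comm, habs, mul_comm]

theorem exists_dotProduct_eq_slopeNorm (w b : Fin p → ℝ) :
    ∃ v ∈ signPermutahedron w, v ⬝ᵥ b = slopeNorm w b := by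
  obtain ⟨v, hv, h⟩ := exists_common_maximizer w b
  refine ⟨v, hv, h b (fun i => ?_) fun i j hij => hij⟩
  split_ifs with h0
  · simpa using h0
  · simpa using (not_le.1 h0).le

/-- By convexity it is enough to check the generating points, where this is the rearrangement
inequality. -/
theorem dotProduct_le_slopeNorm (hw : Antitone w) (hpos : ∀ j, 0 < w j) {x : Fin p → ℝ}
    (hx : x ∈ signPermutahedron w) (b : Fin p → ℝ) : x ⬝ᵥ b ≤ slopeNorm w b := by
  have hconv : Convex ℝ {x : Fin p → ℝ | x ⬝ᵥ b ≤ slopeNorm w b} :=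
    convex_halfSpace_le (𝕜 := ℝ) ⟨fun x y => add_dotProduct x y b, fun c x => smul_dotProduct c x b⟩ _
  refine convexHull_min ?_ hconv hx
  rintro _ ⟨σ, π, hσ, rfl⟩
  set τ := Tuple.sort fun i => -|b i|
  calc (fun i => σ i * w (π i)) ⬝ᵥ b ≤ ∑ i, w (π i) * |b i| := by
        refine Finset.sum_le_sum fun i _ => ?_
        change σ i * w (π i) * b i ≤ _
        rw [mul_comm (σ i), mul_assoc]
        refine mul_le_mul_of_nonneg_left ?_ (hpos _).le
        rcases hσ i with h | h <;> rw [h]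
        · simpa using le_abs_self (b i)
        · simpa using neg_le_abs (b i)
    _ = ∑ j, w ((τ.trans π) j) * absSort b j := by
        rw [← Equiv.sum_comp τ]
        rfl
    _ ≤ slopeNorm w b :=
        (hw.monovary (absSort_antitone b)).sum_comp_perm_mul_le_sum_mul

theorem slopeNorm_add_le (hw : Antitone w) (hpos : ∀ j, 0 < w j) (a b : Fin p → ℝ) :
    slopeNorm w (a + b) ≤ slopeNorm w a + slopeNorm w b := by
  obtain ⟨v, hv, h⟩ := exists_dotProduct_eq_slopeNorm w (a + b)
  rw [← h, dotProduct_add]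
  exact add_le_add (dotProduct_le_slopeNorm hw hpos hv a) (dotProduct_le_slopeNorm hw hpos hv b)

theorem slopeNorm_smul (hw : Antitone w) (hpos : ∀ j, 0 < w j) {t : ℝ} (ht : 0 ≤ t)
    (b : Fin p → ℝ) : slopeNorm w (t • b) = t * slopeNorm w b := by
  refine le_antisymm ?_ ?_
  · obtain ⟨v, hv, h⟩ := exists_dotProduct_eq_slopeNorm w (t • b)
    rw [← h, dotProduct_smul, smul_eq_mul]
    exact mul_le_mul_of_nonneg_left (dotProduct_le_slopeNorm hw hpos hv b) ht
  · obtain ⟨v, hv, h⟩ := exists_dotProduct_eq_slopeNorm w b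
    rw [← h, ← smul_eq_mul, ← dotProduct_smul]
    exact dotProduct_le_slopeNorm hw hpos hv _

theorem slopeNorm_zero (hw : Antitone w) (hpos : ∀ j, 0 < w j) :
    slopeNorm w (0 : Fin p → ℝ) = 0 := by
  simpa using slopeNorm_smul hw hpos le_rfl (0 : Fin p → ℝ)

theorem slopeNorm_sum_le {ι : Type*} (hw : Antitone w) (hpos : ∀ j, 0 < w j) (s : Finset ι)
    (g : ι → Fin p → ℝ) : slopeNorm w (∑ i ∈ s, g i) ≤ ∑ i ∈ s, slopeNorm w (g i) :=
  Finset.le_sum_of_subadditive _ (slopeNorm_zero hw hpos).le (slopeNorm_add_le hw hpos) s g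

theorem convexOn_slopeNorm (hw : Antitone w) (hpos : ∀ j, 0 < w j) :
    ConvexOn ℝ Set.univ (slopeNorm w) := by
  refine ⟨convex_univ, fun a _ b _ s t hs ht _ => ?_⟩
  refine (slopeNorm_add_le hw hpos _ _).trans ?_
  rw [slopeNorm_smul hw hpos hs, slopeNorm_smul hw hpos ht, smul_eq_mul, smul_eq_mul]

theorem continuous_slopeNorm (hw : Antitone w) (hpos : ∀ j, 0 < w j) :
    Continuous (slopeNorm w) :=
  (convexOn_slopeNorm hw hpos).locallyLipschitz.continuous

/-- Provides coercivity. The point with the signs of `b` and unpermuted weights gives `∑ w_i |b_i| ≤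
‖b‖_w`, and `c` is the smallest weight. -/
theorem exists_mul_norm_le_slopeNorm (hw : Antitone w) (hpos : ∀ j, 0 < w j) :
    ∃ c : ℝ, 0 < c ∧ ∀ b, c * ‖b‖ ≤ slopeNorm w b := by
  obtain ⟨c, hc, hcw⟩ : ∃ c : ℝ, 0 < c ∧ ∀ j, c ≤ w j := by
    rcases isEmpty_or_nonempty (Fin p) with h | h
    · exact ⟨1, one_pos, fun j => h.elim j⟩
    · obtain ⟨j, hj⟩ := Finite.exists_min w
      exact ⟨w j, hpos j, hj⟩
  refine ⟨c, hc, fun b => ?_⟩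
  have hsum : ∑ i, w i * |b i| ≤ slopeNorm w b := by
    set ε : Fin p → ℝ := fun i => if 0 ≤ b i then 1 else -1
    have hε : ∀ i, ε i = 1 ∨ ε i = -1 := fun i => by
      simp only [ε]; split_ifs <;> simp
    refine le_trans (le_of_eq ?_) (dotProduct_le_slopeNorm hw hpos
      (subset_convexHull ℝ _ ⟨ε, Equiv.refl _, hε, rfl⟩) b)
    refine Finset.sum_congr rfl fun i _ => ?_
    simp only [ε, Equiv.refl_apply]
    split_ifs with h
    · rw [abs_of_nonneg h]; ring
    · rw [abs_of_neg (not_le.1 h)]; ring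
  have h0 : ∀ i, 0 ≤ w i * |b i| := fun i => mul_nonneg (hpos i).le (abs_nonneg _)
  rw [← le_div_iff₀' hc, pi_norm_le_iff_of_nonneg
    (div_nonneg ((Finset.sum_nonneg fun i _ => h0 i).trans hsum) hc.le)]
  intro i
  rw [le_div_iff₀' hc, Real.norm_eq_abs]
  exact (mul_le_mul_of_nonneg_right (hcw i) (abs_nonneg _)).trans
    ((Finset.single_le_sum (fun i _ => h0 i) (Finset.mem_univ i)).trans hsum)

end Norm

/-! ### Describing the sign permutahedron by finitely many inequalities -/

section Polytope

variable {p : ℕ} {w : Fin p → ℝ}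

theorem isCompact_signPermutahedron (w : Fin p → ℝ) : IsCompact (signPermutahedron w) := by
  refine Set.Finite.isCompact_convexHull ℝ ?_
  have hfin : ((Set.univ.pi fun _ : Fin p => ({1, -1} : Set ℝ)) ×ˢ
      (Set.univ : Set (Equiv.Perm (Fin p)))).Finite :=
    (Set.Finite.pi fun _ => Set.toFinite _).prod Set.finite_univ
  refine (hfin.image fun q => fun i => q.1 i * w (q.2 i)).subset ?_
  rintro _ ⟨σ, π, hσ, rfl⟩
  exact ⟨(σ, π), ⟨fun i _ => by simpa using hσ i, Set.mem_univ _⟩, rfl⟩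

/-- The SLOPE norm is the support function of the sign permutahedron. -/
theorem mem_signPermutahedron_of_dotProduct_le {x : Fin p → ℝ}
    (h : ∀ b, x ⬝ᵥ b ≤ slopeNorm w b) : x ∈ signPermutahedron w := by
  by_contra hx
  obtain ⟨f, u, hf, hu⟩ := geometric_hahn_banach_closed_point (convex_convexHull ℝ _)
    (isCompact_signPermutahedron w).isClosed hx
  have hdot : ∀ z, f z = z ⬝ᵥ fun i => f fun j => if i = j then 1 else 0 := fun z =>
    LinearMap.pi_apply_eq_sum_univ (f : (Fin p → ℝ) →ₗ[ℝ] ℝ) z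
  obtain ⟨v, hv, hvb⟩ := exists_dotProduct_eq_slopeNorm w
    fun i => f fun j => if i = j then 1 else 0
  have h1 := hf v hv
  have h2 := h fun i => f fun j => if i = j then 1 else 0
  rw [hdot] at h1 hu
  linarith

/-- It suffices to test the norm inequality on the vectors with entries in `{-1, 0, 1}`. -/
theorem dotProduct_le_slopeNorm_of_sign {x : Fin p → ℝ}
    (h : ∀ u : Fin p → SignType, x ⬝ᵥ (fun i => (u i : ℝ)) ≤ slopeNorm w fun i => (u i : ℝ))
    (hw : Antitone w) (hpos : ∀ j, 0 < w j) (b : Fin p → ℝ) : x ⬝ᵥ b ≤ slopeNorm w b := by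
  induction hk : (Finset.univ.filter fun i => b i ≠ 0).card using Nat.strong_induction_on
    generalizing b with
  | _ k ih =>
    subst hk
    set S := Finset.univ.filter fun i => b i ≠ 0 with hS
    rcases S.eq_empty_or_nonempty with h0 | hne
    · have : b = 0 := by
        funext i
        by_contra hi
        have : i ∈ S := by simpa [hS] using hi
        simp [h0] at this
      rw [this, dotProduct_zero, slopeNorm_zero hw hpos]
    -- Peel off `c • u`, where `c` is the smallest nonzero absolute value and `u` the sign vector of
    -- `b`. The remainder `b'` has smaller support. Both `u` and `b'` respect the signs and weak
    -- order of `b`, so a single `v` attains all three norms and the norm is additive along `b = c •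
    -- u + b'`.
    obtain ⟨k, hk, hmin⟩ := S.exists_min_image (fun i => |b i|) hne
    simp only [hS, Finset.mem_filter, Finset.mem_univ, true_and] at hk hmin
    set c := |b k|
    have hc : 0 < c := abs_pos.2 hk
    set u : Fin p → ℝ := fun i => (SignType.sign (b i) : ℝ) with hu
    set b' : Fin p → ℝ := b - c • u with hb'
    have hcases : ∀ i, (b i = 0 ∧ u i = 0 ∧ b' i = 0) ∨ (c ≤ b i ∧ u i = 1 ∧ b' i = b i - c) ∨
        (c ≤ - b i ∧ u i = -1 ∧ b' i = b i + c) := fun i => by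
      rcases lt_trichotomy (b i) 0 with hi | hi | hi
      · have := hmin i hi.ne
        rw [abs_of_neg hi] at this
        exact Or.inr (Or.inr ⟨this, by simp [hu, sign_neg hi], by simp [hb', hu, sign_neg hi]⟩)
      · exact Or.inl ⟨hi, by simp [hu, hi], by simp [hb', hu, hi]⟩
      · have := hmin i hi.ne'
        rw [abs_of_pos hi] at this
        exact Or.inr (Or.inl ⟨this, by simp [hu, sign_pos hi], by simp [hb', hu, sign_pos hi]⟩)
    have habs : ∀ i, (|b i| = 0 ∧ |u i| = 0 ∧ |b' i| = 0) ∨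
        (c ≤ |b i| ∧ |u i| = 1 ∧ |b' i| = |b i| - c) := fun i => by
      rcases hcases i with ⟨h1, h2, h3⟩ | ⟨h1, h2, h3⟩ | ⟨h1, h2, h3⟩
      · left; simp [h1, h2, h3]
      · right
        rw [h2, h3, abs_of_nonneg (by linarith : 0 ≤ b i - c), abs_of_nonneg (by linarith : 0 ≤ b i)]
        exact ⟨h1, abs_one, rfl⟩
      · right
        rw [h2, h3, abs_of_nonpos (by linarith : b i + c ≤ 0), abs_of_nonpos (by linarith : b i ≤ 0)]
        exact ⟨h1, by simp, by ring⟩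
    obtain ⟨v, -, hmax⟩ := exists_common_maximizer w b
    have hvb : v ⬝ᵥ b = slopeNorm w b := by
      refine hmax b (fun i => ?_) fun i j hij => hij
      split_ifs with h0
      · simpa using h0
      · simpa using (not_le.1 h0).le
    have hvu : v ⬝ᵥ u = slopeNorm w u := by
      refine hmax u (fun i => ?_) fun i j hij => ?_
      · rcases hcases i with ⟨h1, h2, -⟩ | ⟨h1, h2, -⟩ | ⟨h1, h2, -⟩ <;>
          split_ifs <;> rw [h2] <;> linarith
      · rcases habs i with ⟨h1, h2, -⟩ | ⟨h1, h2, -⟩ <;>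
          rcases habs j with ⟨h1', h2', -⟩ | ⟨h1', h2', -⟩ <;> linarith
    have hvb' : v ⬝ᵥ b' = slopeNorm w b' := by
      refine hmax b' (fun i => ?_) fun i j hij => ?_
      · rcases hcases i with ⟨h1, -, h2⟩ | ⟨h1, -, h2⟩ | ⟨h1, -, h2⟩ <;>
          split_ifs <;> rw [h2] <;> linarith
      · rcases habs i with ⟨h1, -, h2⟩ | ⟨h1, -, h2⟩ <;>
          rcases habs j with ⟨h1', -, h2'⟩ | ⟨h1', -, h2'⟩ <;> linarith
    have hlt : (Finset.univ.filter fun i => b' i ≠ 0).card < S.card := by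
      refine Finset.card_lt_card ((Finset.ssubset_iff_of_subset ?_).2 ⟨k, ?_, ?_⟩)
      · intro i
        simp only [hS, Finset.mem_filter, Finset.mem_univ, true_and]
        rcases habs i with ⟨-, -, h2⟩ | ⟨h1, -, -⟩
        · exact fun hi => absurd (abs_eq_zero.1 h2) hi
        · exact fun _ => abs_pos.1 (hc.trans_le h1)
      · simpa [hS] using hk
      · simp only [Finset.mem_filter, Finset.mem_univ, true_and, not_not]
        rcases habs k with ⟨-, -, h2⟩ | ⟨-, -, h2⟩
        · exact abs_eq_zero.1 h2
        · rw [← abs_eq_zero, h2]; simp [c]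
    have h1 := ih _ hlt b' rfl
    have h2 := mul_le_mul_of_nonneg_left (h fun i => SignType.sign (b i)) hc.le
    have hdec : b = c • u + b' := by rw [hb']; abel
    have hx : x ⬝ᵥ b = c * (x ⬝ᵥ u) + x ⬝ᵥ b' := by
      conv_lhs => rw [hdec]
      rw [dotProduct_add, dotProduct_smul, smul_eq_mul]
    have hv : v ⬝ᵥ b = c * (v ⬝ᵥ u) + v ⬝ᵥ b' := by
      conv_lhs => rw [hdec]
      rw [dotProduct_add, dotProduct_smul, smul_eq_mul]
    rw [hvb, hvu, hvb'] at hv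
    rw [hx, hv]
    exact add_le_add h2 h1

end Polytope

/-! ### Orthogonality and dimension counts -/

section Dimension

variable {p : ℕ}

/-- `W` is orthogonal to the direction space of `F`, so the two meet only in `0` and their
dimensions add up to at most `p`. -/
theorem finrank_le_codim {F : Set (Fin p → ℝ)} (W : Submodule ℝ (Fin p → ℝ))
    (h : ∀ g ∈ W, ∀ x ∈ F, ∀ y ∈ F, g ⬝ᵥ x = g ⬝ᵥ y) : Module.finrank ℝ W ≤ codim F := by
  have hle : ∀ g ∈ W, ∀ z ∈ vectorSpan ℝ F, g ⬝ᵥ z = 0 := by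
    intro g hg z hz
    refine Submodule.span_induction (p := fun z _ => g ⬝ᵥ z = 0) ?_ (by simp) ?_ ?_ hz
    · rintro _ ⟨x, hx, y, hy, rfl⟩
      simp only [vsub_eq_sub, dotProduct_sub]
      rw [h g hg x hx y hy, sub_self]
    · intro a b _ _ ha hb
      rw [dotProduct_add, ha, hb, add_zero]
    · intro c a _ ha
      rw [dotProduct_smul, ha, smul_zero]
  have hd : Disjoint W (vectorSpan ℝ F) := by
    rw [Submodule.disjoint_def]
    intro g hg hg'
    exact dotProduct_self_eq_zero.1 (hle g hg g hg')
  have := Submodule.finrank_add_finrank_le_of_disjoint hd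
  rw [Module.finrank_fin_fun] at this
  unfold codim
  omega

/-- If only `0` in `R` is orthogonal to `W`, and `W` has a nonzero element orthogonal to `R`,
then `dim R < dim W`. -/
theorem finrank_lt_of_orthogonal {R W : Submodule ℝ (Fin p → ℝ)}
    (hRW : ∀ d ∈ R, (∀ g ∈ W, d ⬝ᵥ g = 0) → d = 0) {h : Fin p → ℝ} (hW : h ∈ W) (h0 : h ≠ 0)
    (hR : ∀ d ∈ R, d ⬝ᵥ h = 0) : Module.finrank ℝ R < Module.finrank ℝ W := by
  let φ : (Fin p → ℝ) →ₗ[ℝ] Module.Dual ℝ W :=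
    (LinearMap.lcomp ℝ ℝ W.subtype).comp (dotProductBilin ℝ ℝ)
  have hφ : ∀ d (g : W), φ d g = d ⬝ᵥ (g : Fin p → ℝ) := fun d g => rfl
  have hinj : Function.Injective (φ.comp R.subtype) := by
    rw [injective_iff_map_eq_zero]
    intro d hd
    refine Subtype.ext (hRW d d.2 fun g hg => ?_)
    exact LinearMap.congr_fun hd ⟨g, hg⟩
  have hle := LinearMap.finrank_le_finrank_of_injective hinj
  rw [Subspace.dual_finrank_eq] at hle
  -- With equal dimensions the pairing `R → W*` would be onto, so some `d ∈ R` would act on `W` as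
  -- `h` does. Evaluating at `h` gives `h·h = d·h = 0`.
  refine lt_of_le_of_ne hle fun heq => h0 ?_
  obtain ⟨d, hd⟩ := (LinearMap.injective_iff_surjective_of_finrank_eq_finrank
    (heq.trans Subspace.dual_finrank_eq.symm)).1 hinj (φ h)
  have h1 : (d : Fin p → ℝ) ⬝ᵥ h = h ⬝ᵥ h := LinearMap.congr_fun hd ⟨h, hW⟩
  rw [hR d d.2] at h1
  exact dotProduct_self_eq_zero.1 h1.symm

end Dimension

/-! ### Existence and optimality conditions for minimizers -/

section Optimality

variable {n p : ℕ} {w : Fin p → ℝ} {X : Matrix (Fin n) (Fin p) ℝ} {y : Fin n → ℝ}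

theorem objective_eq (X : Matrix (Fin n) (Fin p) ℝ) (w : Fin p → ℝ) (y : Fin n → ℝ)
    (b : Fin p → ℝ) :
    objective X w y b = 1 / 2 * ((y - X *ᵥ b) ⬝ᵥ (y - X *ᵥ b)) + slopeNorm w b := by
  rw [objective, EuclideanSpace.real_norm_sq_eq]
  simp [dotProduct, sq]

theorem minimizers_nonempty (hw : Antitone w) (hpos : ∀ j, 0 < w j)
    (X : Matrix (Fin n) (Fin p) ℝ) (y : Fin n → ℝ) : (minimizers X w y).Nonempty := by
  obtain ⟨c, hc, hcb⟩ := exists_mul_norm_le_slopeNorm hw hpos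
  have hcont : Continuous (objective X w y) := by
    have h1 := continuous_slopeNorm hw hpos
    have h2 : Continuous fun b => X *ᵥ b := by fun_prop
    have h3 : objective X w y = _ := funext (objective_eq X w y)
    rw [h3]
    fun_prop
  refine hcont.exists_forall_le (Filter.tendsto_atTop_mono (fun b => ?_)
    (tendsto_norm_cocompact_atTop.const_mul_atTop hc))
  refine (hcb b).trans ?_
  rw [objective]
  have := sq_nonneg ‖WithLp.toLp 2 (y - X *ᵥ b)‖
  linarith

/-- The variational inequality characterizing SLOPE minimizers. -/
theorem residual_dotProduct_le (hw : Antitone w) (hpos : ∀ j, 0 < w j) {β : Fin p → ℝ}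
    (hβ : β ∈ minimizers X w y) (b : Fin p → ℝ) :
    (y - X *ᵥ β) ⬝ᵥ (X *ᵥ (b - β)) ≤ slopeNorm w b - slopeNorm w β := by
  set r := y - X *ᵥ β with hr
  set e := X *ᵥ (b - β) with he
  -- Compare `β` with `β + t(b - β)` and divide by `t`; the quadratic remainder vanishes as `t →
  -- 0⁺`.
  have key : ∀ t : ℝ, 0 < t → t < 1 →
      r ⬝ᵥ e ≤ slopeNorm w b - slopeNorm w β + t * (1 / 2 * (e ⬝ᵥ e)) := by
    intro t h0 h1
    have hmin := hβ (β + t • (b - β))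
    have hres : y - X *ᵥ (β + t • (b - β)) = r - t • e := by
      rw [mulVec_add, mulVec_smul, hr, he]; abel
    have hconv : slopeNorm w (β + t • (b - β)) ≤
        (1 - t) * slopeNorm w β + t * slopeNorm w b := by
      have := (convexOn_slopeNorm hw hpos).2 (Set.mem_univ β) (Set.mem_univ b)
        (sub_nonneg.2 h1.le) h0.le (by ring)
      rwa [show (1 - t) • β + t • b = β + t • (b - β) by module] at this
    rw [objective_eq, objective_eq, hres, ← hr] at hmin
    have hexp : (r - t • e) ⬝ᵥ (r - t • e) = r ⬝ᵥ r - 2 * t * (r ⬝ᵥ e) + t ^ 2 * (e ⬝ᵥ e) := by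
      simp only [sub_dotProduct, dotProduct_sub, smul_dotProduct, dotProduct_smul, smul_eq_mul,
        dotProduct_comm e r]
      ring
    rw [hexp] at hmin
    have : t * (r ⬝ᵥ e) ≤
        t * (slopeNorm w b - slopeNorm w β + t * (1 / 2 * (e ⬝ᵥ e))) := by
      nlinarith
    exact le_of_mul_le_mul_left this h0
  have hlim : Filter.Tendsto
      (fun t : ℝ => slopeNorm w b - slopeNorm w β + t * (1 / 2 * (e ⬝ᵥ e)))
      (nhdsWithin 0 (Set.Ioi 0)) (nhds (slopeNorm w b - slopeNorm w β + 0 * (1 / 2 * (e ⬝ᵥ e)))) :=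
    (Continuous.tendsto (by fun_prop) 0).mono_left nhdsWithin_le_nhds
  rw [zero_mul, add_zero] at hlim
  refine ge_of_tendsto hlim ?_
  filter_upwards [Ioo_mem_nhdsGT (one_pos (α := ℝ))] with t ht
  exact key t ht.1 ht.2

theorem mulVec_transpose_mem_rowSpace (X : Matrix (Fin n) (Fin p) ℝ) (r : Fin n → ℝ) :
    Xᵀ *ᵥ r ∈ rowSpace X := by
  rw [mulVec_transpose, vecMul_eq_sum]
  exact Submodule.sum_mem _ fun i _ => Submodule.smul_mem _ _ (Submodule.subset_span ⟨i, rfl⟩)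

theorem transpose_mulVec_dotProduct (X : Matrix (Fin n) (Fin p) ℝ) (r : Fin n → ℝ)
    (b : Fin p → ℝ) : (Xᵀ *ᵥ r) ⬝ᵥ b = r ⬝ᵥ (X *ᵥ b) := by
  rw [mulVec_transpose, dotProduct_mulVec]

theorem dotProduct_eq_zero_of_mem_rowSpace {h d : Fin p → ℝ} (hX : X *ᵥ h = 0)
    (hd : d ∈ rowSpace X) : d ⬝ᵥ h = 0 := by
  refine Submodule.span_induction (p := fun d _ => d ⬝ᵥ h = 0) ?_ (by simp) ?_ ?_ hd
  · rintro _ ⟨i, rfl⟩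
    exact congrFun hX i
  · intro a b _ _ ha hb
    rw [add_dotProduct, ha, hb, add_zero]
  · intro c a _ ha
    rw [smul_dotProduct, ha, smul_zero]

/-- By homogeneity, testing the variational inequality at `0` and `2β` gives the equality. The
inequality then reduces to `s·b ≤ ‖b‖_w` for all `b`, which characterizes membership in `P_w^±`. -/
theorem residual_isSubgradient (hw : Antitone w) (hpos : ∀ j, 0 < w j) {β : Fin p → ℝ}
    (hβ : β ∈ minimizers X w y) :
    Xᵀ *ᵥ (y - X *ᵥ β) ∈ signPermutahedron w ∧
      (Xᵀ *ᵥ (y - X *ᵥ β)) ⬝ᵥ β = slopeNorm w β := by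
  have hvar : ∀ b, (Xᵀ *ᵥ (y - X *ᵥ β)) ⬝ᵥ (b - β) ≤ slopeNorm w b - slopeNorm w β := fun b => by
    rw [transpose_mulVec_dotProduct]
    exact residual_dotProduct_le hw hpos hβ b
  have heq : (Xᵀ *ᵥ (y - X *ᵥ β)) ⬝ᵥ β = slopeNorm w β := by
    have h0 := hvar 0
    have h2 := hvar ((2 : ℝ) • β)
    rw [slopeNorm_zero hw hpos, dotProduct_sub, dotProduct_zero] at h0
    rw [slopeNorm_smul hw hpos (by norm_num), dotProduct_sub, dotProduct_smul, smul_eq_mul] at h2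
    linarith
  refine ⟨mem_signPermutahedron_of_dotProduct_le fun b => ?_, heq⟩
  have := hvar b
  rw [dotProduct_sub, heq] at this
  linarith

/-- Adding the two variational inequalities cancels the norms and leaves `‖Xβ - Xγ‖² ≤ 0`. -/
theorem mulVec_eq_of_mem_minimizers (hw : Antitone w) (hpos : ∀ j, 0 < w j)
    {β γ : Fin p → ℝ} (hβ : β ∈ minimizers X w y) (hγ : γ ∈ minimizers X w y) :
    X *ᵥ β = X *ᵥ γ := by
  have h1 := residual_dotProduct_le hw hpos hβ γ
  have h2 := residual_dotProduct_le hw hpos hγ β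
  have h3 : (X *ᵥ β - X *ᵥ γ) ⬝ᵥ (X *ᵥ β - X *ᵥ γ) ≤ 0 := by
    rw [mulVec_sub] at h1 h2
    simp only [sub_dotProduct, dotProduct_sub] at h1 h2 ⊢
    linarith
  exact sub_eq_zero.1 (dotProduct_self_eq_zero.1 (le_antisymm h3
    (Finset.sum_nonneg fun i _ => mul_self_nonneg _)))

end Optimality

/-! ### Faces of large codimension forced by non-uniqueness -/

section Face

variable {p : ℕ} {w : Fin p → ℝ}

/-- The face of the sign permutahedron on which `b` is maximal. -/
def maxFace (w b : Fin p → ℝ) : Set (Fin p → ℝ) :=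
  {x ∈ signPermutahedron w | b ⬝ᵥ x = slopeNorm w b}

theorem isFace_maxFace (hw : Antitone w) (hpos : ∀ j, 0 < w j) (b : Fin p → ℝ) :
    IsFace (signPermutahedron w) (maxFace w b) :=
  ⟨b, slopeNorm w b, fun x hx => by
    rw [dotProduct_comm]; exact dotProduct_le_slopeNorm hw hpos hx b, rfl⟩

/-- If `s` maximizes all elements of the finite set `G` over the sign permutahedron, then
`s` lies in the face of `∑ g ∈ G, g`, and every element of that face maximizes all elements
of `G`. -/
theorem dotProduct_eq_of_mem_maxFace_sum (hw : Antitone w) (hpos : ∀ j, 0 < w j)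
    (G : Finset (Fin p → ℝ)) {s : Fin p → ℝ} (hs : s ∈ signPermutahedron w)
    (hG : ∀ g ∈ G, s ⬝ᵥ g = slopeNorm w g) :
    s ∈ maxFace w (∑ g ∈ G, g) ∧
      ∀ x ∈ maxFace w (∑ g ∈ G, g), ∀ g ∈ G, g ⬝ᵥ x = slopeNorm w g := by
  have h1 : s ⬝ᵥ (∑ g ∈ G, g) = ∑ g ∈ G, slopeNorm w g := by
    rw [dotProduct_sum]; exact Finset.sum_congr rfl hG
  have h2 : slopeNorm w (∑ g ∈ G, g) = ∑ g ∈ G, slopeNorm w g :=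
    le_antisymm (slopeNorm_sum_le hw hpos G fun g => g)
      (h1 ▸ dotProduct_le_slopeNorm hw hpos hs _)
  refine ⟨⟨hs, by rw [dotProduct_comm, h1, h2]⟩, ?_⟩
  rintro x ⟨hx, hxe⟩
  rw [h2, sum_dotProduct] at hxe
  refine (Finset.sum_eq_sum_iff_of_le fun g _ => ?_).1 hxe
  rw [dotProduct_comm]
  exact dotProduct_le_slopeNorm hw hpos hx g

/-- A point of the sign permutahedron can be moved in every direction orthogonal to all the
sign vectors that it maximizes. -/
theorem exists_add_smul_mem_signPermutahedron (hw : Antitone w) (hpos : ∀ j, 0 < w j)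
    {s d : Fin p → ℝ} (hs : s ∈ signPermutahedron w)
    (hd : ∀ u : Fin p → SignType, s ⬝ᵥ (fun i => (u i : ℝ)) = slopeNorm w (fun i => (u i : ℝ)) →
      d ⬝ᵥ (fun i => (u i : ℝ)) = 0) :
    ∃ t : ℝ, 0 < t ∧ s + t • d ∈ signPermutahedron w ∧ s - t • d ∈ signPermutahedron w := by
  -- Only finitely many sign vectors have to be tested: moving along `d` does not change tight
  -- constraints, and slack ones stay valid for small `t`. The factor `e = ±1` covers both
  -- directions.
  have hev : ∀ e : ℝ, ∀ᶠ t : ℝ in nhdsWithin 0 (Set.Ioi 0), ∀ u : Fin p → SignType,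
      (s + (e * t) • d) ⬝ᵥ (fun i => (u i : ℝ)) ≤ slopeNorm w (fun i => (u i : ℝ)) := by
    intro e
    rw [Filter.eventually_all]
    intro u
    simp only [add_dotProduct, smul_dotProduct, smul_eq_mul]
    rcases (dotProduct_le_slopeNorm hw hpos hs fun i => (u i : ℝ)).eq_or_lt with h | h
    · rw [hd u h, h]
      simp
    · have hc : Filter.Tendsto (fun t : ℝ => s ⬝ᵥ (fun i => (u i : ℝ)) +
          e * t * (d ⬝ᵥ (fun i => (u i : ℝ)))) (nhds 0) (nhds (s ⬝ᵥ (fun i => (u i : ℝ)) +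
          e * 0 * (d ⬝ᵥ (fun i => (u i : ℝ))))) := Continuous.tendsto (by fun_prop) 0
      rw [mul_zero, zero_mul, add_zero] at hc
      exact ((hc.eventually_lt_const h).filter_mono nhdsWithin_le_nhds).mono fun t ht => ht.le
  obtain ⟨t, ⟨h1, h2⟩, ht⟩ := (((hev 1).and (hev (-1))).and self_mem_nhdsWithin).exists
  refine ⟨t, ht, mem_signPermutahedron_of_dotProduct_le
      (dotProduct_le_slopeNorm_of_sign (fun u => ?_) hw hpos),
    mem_signPermutahedron_of_dotProduct_le
      (dotProduct_le_slopeNorm_of_sign (fun u => ?_) hw hpos)⟩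
  · simpa using h1 u
  · simpa [sub_eq_add_neg] using h2 u

/-- Two different vectors `β`, `γ` maximized at a common point of `R ∩ P_w^±`, with
`β - γ` orthogonal to `R`, force `R` to meet a face of codimension larger than `dim R`. -/
theorem exists_maxFace_codim_gt (hw : Antitone w) (hpos : ∀ j, 0 < w j)
    (R : Submodule ℝ (Fin p → ℝ)) {s β γ : Fin p → ℝ} (hsR : s ∈ R)
    (hs : s ∈ signPermutahedron w) (hβ : s ⬝ᵥ β = slopeNorm w β) (hγ : s ⬝ᵥ γ = slopeNorm w γ)
    (hne : β ≠ γ) (hR : ∀ d ∈ R, d ⬝ᵥ (β - γ) = 0) :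
    ∃ b : Fin p → ℝ, ((R : Set (Fin p → ℝ)) ∩ maxFace w b).Nonempty ∧
      Module.finrank ℝ R < codim (maxFace w b) := by
  classical
  set K : Set (Fin p → ℝ) := (R : Set (Fin p → ℝ)) ∩ maxFace w (∑ g ∈ {β, γ}, g) with hK
  have hclosed : IsClosed {x : Fin p → ℝ | (∑ g ∈ {β, γ}, g) ⬝ᵥ x =
      slopeNorm w (∑ g ∈ {β, γ}, g)} := isClosed_eq (by fun_prop) continuous_const
  have hKc : IsCompact K :=
    ((isCompact_signPermutahedron w).inter_right hclosed).inter_left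
      R.closed_of_finiteDimensional
  obtain ⟨hsmem, hpair⟩ := dotProduct_eq_of_mem_maxFace_sum hw hpos {β, γ} hs (by
    intro g hg
    rcases Finset.mem_insert.1 hg with rfl | hg
    · exact hβ
    · rw [Finset.mem_singleton.1 hg]; exact hγ)
  -- The given `s` may have room to move inside `K`; an extreme point has none.
  obtain ⟨z, hz⟩ := hKc.extremePoints_nonempty ⟨s, hsR, hsmem⟩
  rw [mem_extremePoints] at hz
  obtain ⟨⟨hzR, hzF⟩, hext⟩ := hz
  set T : Finset (Fin p → ℝ) := (Finset.univ.image fun (u : Fin p → SignType) i => (u i : ℝ)).filter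
    fun u => z ⬝ᵥ u = slopeNorm w u with hT
  set G : Finset (Fin p → ℝ) := T ∪ {β, γ} with hGdef
  have hβG : β ∈ G := by simp [hGdef]
  have hγG : γ ∈ G := by simp [hGdef]
  have hzG : ∀ g ∈ G, z ⬝ᵥ g = slopeNorm w g := by
    intro g hg
    rcases Finset.mem_union.1 hg with hg | hg
    · exact (Finset.mem_filter.1 hg).2
    · rw [dotProduct_comm]; exact hpair z hzF g hg
  obtain ⟨hzG', hconst⟩ := dotProduct_eq_of_mem_maxFace_sum hw hpos G hzF.1 hzG
  set W := Submodule.span ℝ (G : Set (Fin p → ℝ)) with hW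
  refine ⟨∑ g ∈ G, g, ⟨z, hzR, hzG'⟩, lt_of_lt_of_le
    (finrank_lt_of_orthogonal (W := W) ?_ (h := β - γ) ?_ (sub_ne_zero.2 hne) hR)
    (finrank_le_codim W ?_)⟩
  -- A direction `d ∈ R` orthogonal to `W` would make `z` the midpoint of `z ± t • d`, both in `K`,
  -- so `d = 0`.
  · intro d hdR hd
    have hdG : ∀ g ∈ G, d ⬝ᵥ g = 0 := fun g hg => hd g (Submodule.subset_span hg)
    obtain ⟨t, ht, h1, h2⟩ := exists_add_smul_mem_signPermutahedron hw hpos (d := d) hzF.1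
      (fun u hu => hdG _ (Finset.mem_union_left _ (Finset.mem_filter.2
        ⟨Finset.mem_image_of_mem _ (Finset.mem_univ u), hu⟩)))
    have hd0 : (∑ g ∈ {β, γ}, g) ⬝ᵥ d = 0 := by
      rw [sum_dotProduct]
      refine Finset.sum_eq_zero fun g hg => ?_
      rw [dotProduct_comm]
      exact hdG g (Finset.mem_union_right _ hg)
    have hmem1 : z + t • d ∈ K := ⟨R.add_mem hzR (R.smul_mem t hdR), h1, by
      rw [dotProduct_add, dotProduct_smul, hd0, smul_zero, add_zero]; exact hzF.2⟩
    have hmem2 : z - t • d ∈ K := ⟨R.sub_mem hzR (R.smul_mem t hdR), h2, by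
      rw [dotProduct_sub, dotProduct_smul, hd0, smul_zero, sub_zero]; exact hzF.2⟩
    have heq := (hext _ hmem1 _ hmem2 ⟨1 / 2, 1 / 2, by norm_num, by norm_num, by norm_num, by
      module⟩).1
    exact (smul_eq_zero.1 (by simpa using heq : t • d = 0)).resolve_left ht.ne'
  · exact W.sub_mem (Submodule.subset_span hβG) (Submodule.subset_span hγG)
  · intro g hg x hx x' hx'
    refine Submodule.span_induction (p := fun g _ => g ⬝ᵥ x = g ⬝ᵥ x') ?_ (by simp) ?_ ?_ hg
    · intro g hg
      rw [hconst x hx g hg, hconst x' hx' g hg]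
    · intro a b _ _ ha hb
      rw [add_dotProduct, add_dotProduct, ha, hb]
    · intro c a _ ha
      rw [smul_dotProduct, smul_dotProduct, ha]

end Face

/-! ### Clusters and the codimension of the maximizing face -/

section Clusters

variable {p : ℕ} {w : Fin p → ℝ}

/-- The distinct positive absolute values of the components of `β`. -/
noncomputable def posLevels (β : Fin p → ℝ) : Finset ℝ :=
  (Finset.univ.image fun j => |β j|).filter fun c => 0 < c

theorem mem_posLevels {β : Fin p → ℝ} {c : ℝ} :
    c ∈ posLevels β ↔ (∃ j, |β j| = c) ∧ 0 < c := by
  simp [posLevels]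

/-- The sign vector of the cluster of `β` with absolute value `c`. -/
noncomputable def clusterVec (β : Fin p → ℝ) (c : ℝ) : Fin p → ℝ :=
  fun i => if |β i| = c then (SignType.sign (β i) : ℝ) else 0

/-- The clusters have disjoint supports, so an index in a cluster reads off its coefficient. -/
theorem linearIndependent_clusterVec (β : Fin p → ℝ) :
    LinearIndependent ℝ fun c : posLevels β => clusterVec β c := by
  rw [Fintype.linearIndependent_iff]
  intro h hsum c
  obtain ⟨⟨i, hi⟩, hc⟩ := mem_posLevels.1 c.2
  have h1 := congrFun hsum i
  rw [Finset.sum_apply, Finset.sum_eq_single c] at h1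
  · have hne : β i ≠ 0 := abs_pos.1 (hi ▸ hc)
    rcases lt_or_gt_of_ne hne with h0 | h0
    · simpa [clusterVec, hi, sign_neg h0] using h1
    · simpa [clusterVec, hi, sign_pos h0] using h1
  · intro c' _ hcc
    have : |β i| ≠ c' := fun hc' => hcc (Subtype.ext (hc'.symm.trans hi))
    simp [clusterVec, this]
  · simp

/-- Cluster vectors are constant on the face of the sign permutahedron maximizing `β`. -/
theorem clusterVec_dotProduct_eq (hw : Antitone w) (hpos : ∀ j, 0 < w j) (β : Fin p → ℝ) {c : ℝ}
    (hc : 0 < c) :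
    ∃ a : ℝ, ∀ x ∈ maxFace w β, clusterVec β c ⬝ᵥ x = a := by
  obtain ⟨v, -, hv⟩ := exists_common_maximizer w β
  set g := clusterVec β c with hg
  -- Shifting one cluster by at most `δ` reverses no sign (`δ ≤ c`) and lets no two clusters cross
  -- (`δ` at most every gap). So `v` stays a maximizer along `β + t • g`.
  have hgap : ∃ δ : ℝ, 0 < δ ∧ δ ≤ c ∧ ∀ i j, |β j| < |β i| → δ ≤ |β i| - |β j| := by
    have : ∀ᶠ t : ℝ in nhdsWithin 0 (Set.Ioi 0), ∀ i j, |β j| < |β i| → t ≤ |β i| - |β j| := by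
      rw [Filter.eventually_all]
      intro i
      rw [Filter.eventually_all]
      intro j
      rw [Filter.eventually_imp_distrib_left]
      intro hij
      filter_upwards [Ioc_mem_nhdsGT (sub_pos.2 hij)] with t ht using ht.2
    obtain ⟨δ, h1, h2⟩ := (this.and (Ioc_mem_nhdsGT hc)).exists
    exact ⟨δ, h2.1, h2.2, h1⟩
  obtain ⟨δ, hδ, hδc, hgap⟩ := hgap
  have hattain : ∀ t : ℝ, |t| ≤ δ → v ⬝ᵥ (β + t • g) = slopeNorm w (β + t • g) := by
    intro t ht
    obtain ⟨ht1, ht2⟩ := abs_le.1 ht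
    set e : Fin p → ℝ := fun i => if |β i| = c then t else 0 with he
    have hval : ∀ i, (0 ≤ β i ∧ (β + t • g) i = |β i| + e i) ∨
        (β i < 0 ∧ (β + t • g) i = -(|β i| + e i)) := by
      intro i
      have hi : (β + t • g) i = β i + SignType.sign (β i) * e i := by
        by_cases hi : |β i| = c
        · simp [hg, clusterVec, he, hi, mul_comm]
        · simp [hg, clusterVec, he, hi]
      rw [hi]
      rcases lt_trichotomy (β i) 0 with h | h | h
      · refine Or.inr ⟨h, ?_⟩
        rw [sign_neg h, abs_of_neg h, SignType.coe_neg_one]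
        ring
      · have he0 : e i = 0 := by simp [he, h, hc.ne]
        exact Or.inl ⟨h.ge, by simp [h, he0]⟩
      · exact Or.inl ⟨h.le, by rw [sign_pos h, abs_of_pos h, SignType.coe_one, one_mul]⟩
    have hnn : ∀ i, 0 ≤ |β i| + e i := fun i => by
      by_cases hi : |β i| = c
      · simp only [he, if_pos hi]; linarith
      · simp only [he, if_neg hi]; positivity
    have habs : ∀ i, |(β + t • g) i| = |β i| + e i := fun i => by
      rcases hval i with ⟨-, h⟩ | ⟨-, h⟩ <;> rw [h]
      · exact abs_of_nonneg (hnn i)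
      · rw [abs_neg, abs_of_nonneg (hnn i)]
    refine hv _ (fun i => ?_) fun i j hij => ?_
    · rcases hval i with ⟨h0, h⟩ | ⟨h0, h⟩ <;> rw [h]
      · rw [if_pos h0, one_mul]; exact hnn i
      · rw [if_neg (not_le.2 h0), neg_one_mul, neg_neg]; exact hnn i
    · rw [habs, habs]
      rcases hij.eq_or_lt with h | h
      · simp only [he, h]; exact le_rfl
      · have := hgap i j h
        by_cases hi : |β i| = c
        · have hj : |β j| ≠ c := fun hj => by linarith
          simp only [he, if_pos hi, if_neg hj]; linarith
        · simp only [he, if_neg hi]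
          split_ifs <;> linarith
  have h0 : v ⬝ᵥ β = slopeNorm w β := by
    simpa using hattain 0 (by simpa using hδ.le)
  refine ⟨g ⬝ᵥ v, fun x hx => ?_⟩
  -- Both `x` and `v` attain the norm at `β`, and `v` does so also at `β + t • g`. Taking `t = ±δ`
  -- forces `g·x = g·v`.
  have hle : ∀ t : ℝ, |t| ≤ δ → t * (g ⬝ᵥ x) ≤ t * (g ⬝ᵥ v) := by
    intro t ht
    have h1 := dotProduct_le_slopeNorm hw hpos hx.1 (β + t • g)
    rw [← hattain t ht, dotProduct_comm x, dotProduct_comm v] at h1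
    simp only [add_dotProduct, smul_dotProduct, smul_eq_mul] at h1
    rw [hx.2, dotProduct_comm β v, h0] at h1
    linarith
  have h1 := hle δ (abs_of_pos hδ).le
  have h2 := hle (-δ) (by rw [abs_neg, abs_of_pos hδ])
  exact le_antisymm (le_of_mul_le_mul_left h1 hδ)
    (le_of_mul_le_mul_left (by linarith : δ * (g ⬝ᵥ v) ≤ δ * (g ⬝ᵥ x)) hδ)

theorem card_posLevels_le_codim (hw : Antitone w) (hpos : ∀ j, 0 < w j) (β : Fin p → ℝ) :
    (posLevels β).card ≤ codim (maxFace w β) := by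
  have h := finrank_span_eq_card (linearIndependent_clusterVec β)
  rw [Fintype.card_coe] at h
  rw [← h]
  refine finrank_le_codim _ fun g hg x hx y hy => ?_
  refine Submodule.span_induction (p := fun g _ => g ⬝ᵥ x = g ⬝ᵥ y) ?_ (by simp) ?_ ?_ hg
  · rintro _ ⟨c, rfl⟩
    obtain ⟨a, ha⟩ := clusterVec_dotProduct_eq hw hpos β (mem_posLevels.1 c.2).2
    exact (ha x hx).trans (ha y hy).symm
  · intro a b _ _ ha hb
    rw [add_dotProduct, add_dotProduct, ha, hb]
  · intro c a _ ha
    rw [smul_dotProduct, smul_dotProduct, ha]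

/-- An entry of largest absolute value has all positive levels at or below it, so its rank counts
them all. -/
theorem norm_mdl (β : Fin p → ℝ) : ‖mdl β‖ = ((posLevels β).card : ℝ) := by
  have hn : ∀ i, ‖mdl β i‖ = ((levels β |β i|).card : ℝ) := fun i => by
    rw [Int.norm_eq_abs, ← Int.cast_abs, abs_mdl, Int.cast_natCast]
  have hsub : ∀ t, levels β t ⊆ posLevels β := fun t c hc => by
    simp only [levels, posLevels, Finset.mem_filter] at hc ⊢
    exact ⟨hc.1, hc.2.1⟩
  refine le_antisymm ((pi_norm_le_iff_of_nonneg (Nat.cast_nonneg _)).2 fun i => ?_) ?_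
  · rw [hn]
    exact_mod_cast Finset.card_le_card (hsub _)
  · rcases (posLevels β).eq_empty_or_nonempty with h | h
    · rw [h]; simp
    · obtain ⟨c, hc, hmax⟩ := (posLevels β).exists_max_image id h
      obtain ⟨⟨i, hi⟩, -⟩ := mem_posLevels.1 hc
      refine le_trans ?_ (norm_le_pi_norm (mdl β) i)
      rw [hn, hi]
      have : posLevels β ⊆ levels β c := fun d hd => by
        have hdc := hmax d hd
        simp only [levels, posLevels, Finset.mem_filter] at hd ⊢
        exact ⟨hd.1, hd.2, hdc⟩
      exact_mod_cast Finset.card_le_card this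

theorem ncard_nonNullClusters (β : Fin p → ℝ) :
    (nonNullClusters β).ncard = (posLevels β).card := by
  have h : nonNullClusters β = (fun c => {i | |β i| = c}) '' (posLevels β : Set ℝ) := by
    ext C
    simp only [nonNullClusters, Set.mem_ofPred_eq, Set.mem_image, Finset.mem_coe, mem_posLevels]
    constructor
    · rintro ⟨⟨i, hi⟩, c, hc, rfl⟩
      exact ⟨c, ⟨⟨i, hi⟩, hc⟩, rfl⟩
    · rintro ⟨c, ⟨⟨i, hi⟩, hc⟩, rfl⟩
      exact ⟨⟨i, hi⟩, c, hc, rfl⟩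
  rw [h, Set.InjOn.ncard_image, Set.ncard_coe_finset]
  intro c hc d _ hcd
  obtain ⟨⟨i, hi⟩, -⟩ := mem_posLevels.1 hc
  have hid : |β i| = d := (Set.ext_iff.1 hcd i).1 hi
  exact hi.symm.trans hid

end Clusters

end SLOPE

/-! ### The main theorem -/

open SLOPE in
theorem mainTheorem8 (n p : ℕ) (X : Matrix (Fin n) (Fin p) ℝ) (w : Fin p → ℝ)
    (hw_anti : StrictAnti w) (hw_pos : ∀ j, 0 < w j)
    (hX : ∀ F : Set (Fin p → ℝ), SLOPE.IsFace (SLOPE.signPermutahedron w) F →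
      X.rank < SLOPE.codim F → (SLOPE.rowSpace X : Set (Fin p → ℝ)) ∩ F = ∅) :
    ∀ y : Fin n → ℝ, ∃ β : Fin p → ℝ, SLOPE.minimizers X w y = {β} ∧
      ((SLOPE.nonNullClusters β).ncard : ℝ) = ‖SLOPE.mdl β‖ ∧
      ‖SLOPE.mdl β‖ ≤ (X.rank : ℝ) := by
  intro y
  have hw := hw_anti.antitone
  have hrank : X.rank = Module.finrank ℝ (rowSpace X) := X.rank_eq_finrank_span_row
  have hface : ∀ b : Fin p → ℝ, ((rowSpace X : Set (Fin p → ℝ)) ∩ maxFace w b).Nonempty →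
      codim (maxFace w b) ≤ X.rank := fun b hne => by
    by_contra! hlt
    exact hne.ne_empty (hX _ (isFace_maxFace hw hw_pos b) hlt)
  obtain ⟨β, hβ⟩ := minimizers_nonempty hw hw_pos X y
  obtain ⟨hs, hsβ⟩ := residual_isSubgradient hw hw_pos hβ
  have hrow := mulVec_transpose_mem_rowSpace X (y - X.mulVec β)
  refine ⟨β, Set.eq_singleton_iff_unique_mem.2 ⟨hβ, fun γ hγ => ?_⟩, ?_, ?_⟩
  · by_contra hne
    have hXeq := mulVec_eq_of_mem_minimizers hw hw_pos hγ hβ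
    obtain ⟨-, hsγ⟩ := residual_isSubgradient hw hw_pos hγ
    -- Equal fits give equal residuals, so one and the same point of `row(X)` maximizes both `β` and
    -- `γ`.
    rw [hXeq] at hsγ
    have h0 : X.mulVec (γ - β) = 0 := by rw [Matrix.mulVec_sub, hXeq, sub_self]
    obtain ⟨b, hb, hlt⟩ := exists_maxFace_codim_gt hw hw_pos (rowSpace X) hrow hs hsγ hsβ hne
      fun d hd => dotProduct_eq_zero_of_mem_rowSpace h0 hd
    have := hface b hb
    omega
  · rw [ncard_nonNullClusters, norm_mdl]
  · rw [norm_mdl]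
    have h := hface β ⟨_, hrow, hs, by rw [dotProduct_comm]; exact hsβ⟩
    exact_mod_cast (card_posLevels_le_codim hw hw_pos β).trans h
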